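/- **Corollary 4.4.** Let $n\ge 0$ be an integer and let $\Gamma$ be an Artin algebra, that is, a ring which is a finitely generated module over a commutative artinian ring $R$ via an $R$-algebra structure. Modules are left modules, $\Gamma\text{-mod}$ denotes the category of finitely generated $\Gamma$-modules, $\mathrm{pd}$ denotes projective dimension, and $\mathrm{soc}\,N$ is the sum of the simple submodules of $N$. The global dimension $\mathrm{gldim}\,\Gamma$ is the supremum of $\mathrm{pd}\,N$ over all $N\in\Gamma\text{-mod}$. The dominant dimension $\mathrm{domdim}\,\Gamma$ is the supremum in $\mathbb N\cup\{\infty\}$ of all $d$ such that, in a minimal injective coresolution $0\to\Gamma\to I_0\to I_1\to\cdots$ of the left module $\Gamma$, the module $I_j$ is projective for all $0\le j<d$. The algebra $\Gamma$ is called an *$n$-Auslander algebra* if $\mathrm{gldim}\,\Gamma\le n+1\le\mathrm{domdim}\,\Gamma$. Let $\mathrm P^{\le n}(\Gamma)$ be the full subcategory of those $N\in\Gamma\text{-mod}$ with $\mathrm{pd}\,N\le n$, and let $\mathrm{sub}\,\Gamma$ be the full subcategory of those $N\in\Gamma\text{-mod}$ that embed into $\Gamma^k$ for some $k\in\mathbb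 N$. Then $\Gamma$ is an $n$-Auslander algebra if and only if $$\mathrm P^{\le n}(\Gamma)=\{N\in\Gamma\text{-mod}\mid \mathrm{pd}(\mathrm{soc}\,N)\le n\}=\mathrm{sub}\,\Gamma .$$ -/

import Mathlib

open CategoryTheory

universe u

namespace ArtinAlg

/-- The socle of a module: the sum of its simple submodules. -/
def socle (Γ : Type u) [Ring Γ] (N : Type u) [AddCommGroup N] [Module Γ N] : Submodule Γ N :=
  sSup {S : Submodule Γ N | IsSimpleModule Γ S}

/-- A submodule is essential if it meets every nonzero submodule nontrivially. -/
def IsEssential {Γ : Type u} [Ring Γ] {N : Type u} [AddCommGroup N] [Module Γ N]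
    (K : Submodule Γ N) : Prop :=
  ∀ L : Submodule Γ N, K ⊓ L = ⊥ → L = ⊥

/-- An injective coresolution `0 → M → I⁰ → I¹ → ⋯` is minimal if the kernel of each
`Iⁱ → Iⁱ⁺¹` is an essential submodule of `Iⁱ`. By exactness this kernel is the image of the
preceding map, so this says that `Iⁱ` is an injective envelope of that image. -/
def IsMinimal {Γ : Type u} [Ring Γ] {M : ModuleCat.{u} Γ} (I : InjectiveResolution M) : Prop :=
  ∀ i : ℕ, IsEssential (LinearMap.ker (I.cocomplex.d i (i + 1)).hom)

/-- The dominant dimension of `Γ`: the supremum (possibly `∞`) of all `d` such that the terms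
`I⁰, …, I^{d-1}` of a minimal injective coresolution of the left regular module are projective. -/
noncomputable def domdim (Γ : Type u) [Ring Γ] : ℕ∞ :=
  sSup {d : ℕ∞ | ∃ I : InjectiveResolution (ModuleCat.of Γ Γ), IsMinimal I ∧
    ∀ j : ℕ, (j : ℕ∞) < d → Module.Projective Γ (I.cocomplex.X j)}

/-- The projective dimension of a module; it is `⊥` for the zero module. -/
noncomputable def pd (Γ : Type u) [Ring Γ] (N : Type u) [AddCommGroup N] [Module Γ N] :
    WithBot ℕ∞ :=
  projectiveDimension (ModuleCat.of Γ N)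

/-- The (left) global dimension of an Artin algebra: the supremum of the projective dimensions of
the finitely generated left modules. -/
noncomputable def gldim (Γ : Type u) [Ring Γ] : WithBot ℕ∞ :=
  ⨆ N : FGModuleCat.{u} Γ, pd Γ N

/-- `Γ` is an `n`-Auslander algebra: `gldim Γ ≤ n + 1 ≤ domdim Γ`. -/
def IsAuslander (n : ℕ) (Γ : Type u) [Ring Γ] : Prop :=
  gldim Γ ≤ ((n + 1 : ℕ) : WithBot ℕ∞) ∧ ((n + 1 : ℕ) : ℕ∞) ≤ domdim Γ

/-- The finitely generated modules of projective dimension at most `n`. -/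
def projDimLE (n : ℕ) (Γ : Type u) [Ring Γ] : ObjectProperty (FGModuleCat.{u} Γ) :=
  fun N => pd Γ N ≤ (n : WithBot ℕ∞)

/-- The finitely generated modules whose socle has projective dimension at most `n`. -/
def socleProjDimLE (n : ℕ) (Γ : Type u) [Ring Γ] : ObjectProperty (FGModuleCat.{u} Γ) :=
  fun N => pd Γ (socle Γ N) ≤ (n : WithBot ℕ∞)

/-- The finitely generated modules cogenerated by `Γ`, that is, embeddable in some `Γᵏ`. -/
def subReg (Γ : Type u) [Ring Γ] : ObjectProperty (FGModuleCat.{u} Γ) :=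
  fun N => ∃ (k : ℕ) (f : N →ₗ[Γ] (Fin k → Γ)), Function.Injective f

end ArtinAlg

/-! Both other classes are compared with `sub Γ`.

Suppose `Γ` is `n`-Auslander. A submodule of `Γᵏ` is a first syzygy, so `gldim Γ ≤ n + 1` gives it
`pd ≤ n`. Conversely let `pd N ≤ n` and let `S ⊆ N` be simple with `Hom(S, Γ) = 0`. Then `S` has no
nonzero map to the projective terms `I⁰, …, Iⁿ`, so `Extʲ(S, Γ) = 0` for `j ≤ n`. Shifting along a
free resolution of `N` gives `Hom(S, N) = 0`, which is absurd
(`cogenerated_of_hasProjectiveDimensionLT`). Hence every simple submodule of `N` maps nontrivially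
to `Γ`, and injectivity of `I⁰` turns this into an embedding of `N` in some `Γᵏ`. That criterion
sees only the socle, which settles the third class.

Suppose the classes agree. Syzygies lie in `sub Γ`, so `gldim Γ ≤ n + 1`. Finitely generated
submodules of `I⁰` have socle inside `Γ`, hence lie in `sub Γ`; a length bound makes `I⁰` itself
finitely generated, so it embeds in some `Γᵏ`, splits off and is projective. Inductively the
cocycles `Zʲ` have `pd ≤ j ≤ n`, so they lie in `sub Γ`, and so do their hulls `Iʲ`
(`projective_of_isMinimal`). -/

namespace ArtinAlg

/-! ### Modules cogenerated by `Γ` -/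

section Cogenerated

variable {Γ : Type u} [Ring Γ]

/-- A module is cogenerated by `Γ` if it embeds into some `Γᵏ`. -/
def Cogenerated (Γ : Type u) [Ring Γ] (M : Type u) [AddCommGroup M] [Module Γ M] : Prop :=
  ∃ (k : ℕ) (f : M →ₗ[Γ] (Fin k → Γ)), Function.Injective f

variable {M N : Type u} [AddCommGroup M] [Module Γ M] [AddCommGroup N] [Module Γ N]

theorem Cogenerated.of_injective (hN : Cogenerated Γ N) (g : M →ₗ[Γ] N)
    (hg : Function.Injective g) : Cogenerated Γ M := by
  obtain ⟨k, f, hf⟩ := hN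
  exact ⟨k, f ∘ₗ g, hf.comp hg⟩

theorem Cogenerated.exists_apply_ne_zero (hM : Cogenerated Γ M) {x : M} (hx : x ≠ 0) :
    ∃ f : M →ₗ[Γ] Γ, f x ≠ 0 := by
  obtain ⟨k, f, hf⟩ := hM
  by_contra! h
  refine hx (hf ?_)
  rw [map_zero]
  ext i
  exact h (LinearMap.proj i ∘ₗ f)

/-- Finitely many members of a family of maps on an artinian module suffice to be jointly
injective. -/
theorem cogenerated_of_separating [IsArtinian Γ M]
    (h : ∀ x : M, x ≠ 0 → ∃ f : M →ₗ[Γ] Γ, f x ≠ 0) : Cogenerated Γ M := by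
  -- By the descending chain condition, finitely many kernels already have the intersection of all
  -- of them.
  obtain ⟨s, hs⟩ := Finset.exists_inf_le (fun f : M →ₗ[Γ] Γ => LinearMap.ker f)
  refine ⟨s.card, LinearMap.pi fun i => (s.equivFin.symm i : M →ₗ[Γ] Γ), ?_⟩
  rw [← LinearMap.ker_eq_bot, LinearMap.ker_eq_bot']
  intro x hx
  by_contra hne
  obtain ⟨f, hf⟩ := h x hne
  refine hf (hs f ?_)
  rw [Submodule.mem_finsetInf]
  intro g hg
  have := congrFun hx (s.equivFin ⟨g, hg⟩)
  simpa using this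

theorem exists_apply_ne_zero_of_projective [Module.Projective Γ M] {x : M} (hx : x ≠ 0) :
    ∃ f : M →ₗ[Γ] Γ, f x ≠ 0 := by
  obtain ⟨s, hs⟩ := Module.projective_def'.mp ‹Module.Projective Γ M›
  by_contra! h
  refine hx ?_
  have h0 : s x = 0 := by
    ext i
    exact h (Finsupp.lapply i ∘ₗ s)
  have := LinearMap.congr_fun hs x
  simpa [h0] using this.symm

theorem IsEssential.injective {K : Submodule Γ M} (hK : IsEssential K) (f : M →ₗ[Γ] N)
    (hf : ∀ x ∈ K, f x = 0 → x = 0) : Function.Injective f := by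
  rw [← LinearMap.ker_eq_bot]
  refine hK _ ?_
  rw [eq_bot_iff]
  rintro x ⟨hx, hfx⟩
  exact hf x hx hfx

theorem exists_isSimpleModule_le [IsArtinian Γ M] {L : Submodule Γ M} (hL : L ≠ ⊥) :
    ∃ S : Submodule Γ M, IsSimpleModule Γ S ∧ S ≤ L := by
  obtain ⟨S, hS, hle⟩ := (eq_bot_or_exists_atom_le L).resolve_left hL
  exact ⟨S, isSimpleModule_iff_isAtom.mpr hS, hle⟩

/-- If `Γ` embeds into a projective injective module, then a module of finite length is
cogenerated by `Γ` as soon as each of its simple submodules has a nonzero map to `Γ`. -/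
theorem cogenerated_of_simple [IsArtinian Γ M] {I : Type u} [AddCommGroup I] [Module Γ I]
    [Module.Injective Γ I] [Module.Projective Γ I] (ι : Γ →ₗ[Γ] I) (hι : Function.Injective ι)
    (h : ∀ S : Submodule Γ M, IsSimpleModule Γ S → ∃ f : S →ₗ[Γ] Γ, f ≠ 0) :
    Cogenerated Γ M := by
  refine cogenerated_of_separating fun x hx => ?_
  obtain ⟨S, hS, hle⟩ := exists_isSimpleModule_le (L := Γ ∙ x) (by simpa using hx)
  obtain ⟨f, hf⟩ := h S hS
  obtain ⟨g, hg⟩ := Module.Injective.extension_property _ _ _ _ S.subtype S.subtype_injective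
    (ι ∘ₗ f)
  -- Since `S ≤ Γ ∙ x`, a map killing `x` would kill `S`, although `g` extends the nonzero map `ι ∘ₗ
  -- f`.
  have hgx : g x ≠ 0 := by
    intro h0
    refine hf (LinearMap.ext fun y => hι ?_)
    obtain ⟨r, hr⟩ := Submodule.mem_span_singleton.mp (hle y.2)
    have := LinearMap.congr_fun hg y
    simp only [LinearMap.comp_apply, Submodule.subtype_apply] at this
    rw [← this, ← hr]
    simp [h0]
  obtain ⟨p, hp⟩ := exists_apply_ne_zero_of_projective (Γ := Γ) hgx
  exact ⟨p ∘ₗ g, hp⟩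

theorem socle_ge {S : Submodule Γ M} (hS : IsSimpleModule Γ S) : S ≤ socle Γ M :=
  le_sSup hS

end Cogenerated

/-! ### Injective hulls -/

section Hull

variable {Γ : Type u} [Ring Γ] {M : Type u} [AddCommGroup M] [Module Γ M]

theorem exists_maximal_disjoint (A B : Submodule Γ M) (h : A ⊓ B = ⊥) :
    ∃ A' : Submodule Γ M, A ≤ A' ∧ A' ⊓ B = ⊥ ∧ ∀ L, A' ≤ L → L ⊓ B = ⊥ → L = A' := by
  obtain ⟨A', hle, hmax⟩ := zorn_le_nonempty₀ {L : Submodule Γ M | L ⊓ B = ⊥} (by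
    intro c hc hchain y hy
    refine ⟨sSup c, ?_, fun z hz => le_sSup hz⟩
    have : Disjoint (sSup c) B :=
      (DirectedOn.disjoint_sSup_left hchain.directedOn).mpr fun L hL => disjoint_iff.mpr (hc hL)
    exact disjoint_iff.mp this) A h
  exact ⟨A', hle, hmax.prop, fun L hL hLB => (hmax.eq_of_le hLB hL).symm⟩

/-- Every submodule of an injective module is essential in a direct summand. -/
theorem exists_essential_retract [Module.Injective Γ M] (K : Submodule Γ M) :
    ∃ (E : Submodule Γ M) (r : M →ₗ[Γ] E), K ≤ E ∧ (∀ x : E, r x = x) ∧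
      ∀ L : Submodule Γ M, L ≤ E → K ⊓ L = ⊥ → L = ⊥ := by
  obtain ⟨C, -, hCK, hC⟩ := exists_maximal_disjoint (⊥ : Submodule Γ M) K (bot_inf_eq _)
  obtain ⟨E, hKE, hEC, hE⟩ := exists_maximal_disjoint K C (by rwa [inf_comm])
  have hinj : Function.Injective (C.mkQ ∘ₗ E.subtype) := by
    rw [← LinearMap.ker_eq_bot, LinearMap.ker_eq_bot']
    intro x hx
    have hx' : (x : M) ∈ E ⊓ C := ⟨x.2, by simpa using hx⟩
    rw [hEC] at hx'
    simpa using hx'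
  -- `E` embeds in `M ⧸ C`; extending its inclusion into `M` along this embedding gives a candidate
  -- for the projection onto `E`. The two maximality properties show that its image is no larger
  -- than `E`.
  obtain ⟨g, hg⟩ := Module.Injective.extension_property _ _ _ _ _ hinj E.subtype
  have hgE : ∀ x ∈ E, g (C.mkQ x) = x := fun x hx => LinearMap.congr_fun hg ⟨x, hx⟩
  have hC0 : ∀ x ∈ C, g (C.mkQ x) = 0 := fun x hx => by
    rw [Submodule.mkQ_apply, (Submodule.Quotient.mk_eq_zero C).mpr hx, map_zero]
  have hcomap : C.comap (g ∘ₗ C.mkQ) = C := by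
    refine hC _ (fun x hx => ?_) ?_
    · change g (C.mkQ x) ∈ C
      rw [hC0 x hx]
      exact C.zero_mem
    · rw [eq_bot_iff]
      rintro x ⟨hx, hxK⟩
      change g (C.mkQ x) ∈ C at hx
      rw [hgE x (hKE hxK)] at hx
      rw [← hCK]
      exact ⟨hx, hxK⟩
  have hrange : LinearMap.range (g ∘ₗ C.mkQ) = E := by
    refine hE _ (fun x hx => ⟨x, hgE x hx⟩) ?_
    rw [eq_bot_iff]
    rintro _ ⟨⟨x, rfl⟩, hx⟩
    have : x ∈ C := hcomap ▸ hx
    exact hC0 x this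
  refine ⟨E, (g ∘ₗ C.mkQ).codRestrict E fun x => hrange ▸ ⟨x, rfl⟩, hKE,
    fun x => Subtype.ext (hgE x x.2), fun L hLE hKL => ?_⟩
  have hCL : C ⊔ L = C := by
    refine hC _ le_sup_left ?_
    rw [eq_bot_iff]
    rintro k ⟨hk, hkK⟩
    obtain ⟨c, hc, l, hl, rfl⟩ := Submodule.mem_sup.mp hk
    have hcE : c ∈ E ⊓ C := ⟨by simpa using E.sub_mem (hKE hkK) (hLE hl), hc⟩
    rw [hEC, Submodule.mem_bot] at hcE
    subst hcE
    rw [← hKL]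
    exact ⟨hkK, by simpa using hl⟩
  rw [eq_bot_iff, ← hEC]
  exact le_inf hLE (hCL ▸ le_sup_right)

theorem injective_of_retract {E : Type u} [AddCommGroup E] [Module Γ E] [Module.Injective Γ M]
    (i : E →ₗ[Γ] M) (r : M →ₗ[Γ] E) (h : ∀ x, r (i x) = x) : Module.Injective Γ E where
  out X Y _ _ _ _ f hf g := by
    obtain ⟨k, hk⟩ := Module.Injective.out f hf (i ∘ₗ g)
    exact ⟨r ∘ₗ k, fun x => by simp [hk, h]⟩

variable (Γ M) in
/-- Every module has an injective hull. -/
theorem exists_injective_hull : ∃ (E : ModuleCat.{u} Γ) (f : M →ₗ[Γ] E),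
    Function.Injective f ∧ Module.Injective Γ E ∧ IsEssential (LinearMap.range f) := by
  let J := Injective.under (ModuleCat.of Γ M)
  let ι : M →ₗ[Γ] J := (Injective.ι (ModuleCat.of Γ M)).hom
  have hι : Function.Injective ι := (ModuleCat.mono_iff_injective _).mp inferInstance
  have : Module.Injective Γ J := Module.injective_module_of_injective_object Γ J
    (inj := inferInstanceAs (Injective (Injective.under _)))
  obtain ⟨E, r, hle, hr, hE⟩ := exists_essential_retract (LinearMap.range ι)
  refine ⟨ModuleCat.of Γ E, ι.codRestrict E fun x => hle ⟨x, rfl⟩, fun x y hxy => hι ?_,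
    injective_of_retract E.subtype r hr, fun L hL => ?_⟩
  · exact congrArg Subtype.val hxy
  · have := hE (L.map E.subtype) (Submodule.map_subtype_le E L) (by
      rw [eq_bot_iff]
      rintro _ ⟨⟨x, rfl⟩, ⟨y, hy, hyx⟩⟩
      have hyL : y ∈ LinearMap.range (ι.codRestrict E fun x => hle ⟨x, rfl⟩) ⊓ L :=
        ⟨⟨x, Subtype.ext hyx.symm⟩, hy⟩
      rw [hL, Submodule.mem_bot] at hyL
      simp [← hyx, hyL])
    exact Submodule.map_injective_of_injective E.subtype_injective
      (this.trans (Submodule.map_bot _).symm)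

end Hull

/-! ### Length bounds and finite generation -/

section Length

variable {Γ : Type u} [Ring Γ] {M : Type u} [AddCommGroup M] [Module Γ M]

/-- In a module of length at most `ℓ`, at most `ℓ` members of a family of submodules with zero
intersection already have zero intersection. -/
theorem exists_finset_card_le_inf_eq_bot [IsArtinian Γ M] [IsNoetherian Γ M] {ι : Type*}
    (K : ι → Submodule Γ M) (hK : ∀ x, (∀ i, x ∈ K i) → x = 0) :
    ∃ s : Finset ι, (s.card : ℕ∞) ≤ Module.length Γ M ∧ s.inf K = ⊥ := by
  classical
  -- Greedy choice: each new member strictly shrinks the intersection, which costs at least one unit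
  -- of length.
  have key : ∀ m : ℕ, ∃ s : Finset ι, s.card + Module.length Γ (s.inf K : Submodule Γ M) ≤
      Module.length Γ M ∧ (s.inf K = ⊥ ∨ m ≤ s.card) := by
    intro m
    induction m with
    | zero => exact ⟨∅, by
      simpa using Module.length_le_of_injective _ (Submodule.subtype_injective _), by simp⟩
    | succ m ih =>
      obtain ⟨s, hs, h | h⟩ := ih
      · exact ⟨s, hs, Or.inl h⟩
      by_cases hbot : s.inf K = ⊥
      · exact ⟨s, hs, Or.inl hbot⟩
      obtain ⟨x, hx, hx0⟩ := (Submodule.ne_bot_iff _).mp hbot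
      obtain ⟨i, hi⟩ : ∃ i, x ∉ K i := by
        by_contra! hc
        exact hx0 (hK x hc)
      have his : i ∉ s := fun his => hi ((Finset.inf_le his : s.inf K ≤ K i) hx)
      have hlt : (insert i s).inf K < s.inf K := by
        rw [Finset.inf_insert]
        exact lt_of_le_of_ne inf_le_right fun he => hi (he.symm ▸ hx : x ∈ K i ⊓ s.inf K).1
      refine ⟨insert i s, le_trans ?_ hs, Or.inr (by rw [Finset.card_insert_of_notMem his]; omega)⟩
      have hlen := Submodule.height_strictMono hlt
      rw [Module.length_submodule, Module.length_submodule, Finset.card_insert_of_notMem his,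
        Nat.cast_add, Nat.cast_one, add_assoc]
      gcongr
      rw [add_comm]
      exact Order.add_one_le_of_lt hlen
  obtain ⟨ℓ, hℓ⟩ := ENat.ne_top_iff_exists.mp (Module.length_ne_top (R := Γ) (M := M))
  obtain ⟨s, hs, h | h⟩ := key (ℓ + 1)
  · exact ⟨s, le_self_add.trans hs, h⟩
  · have : (ℓ + 1 : ℕ) ≤ (ℓ : ℕ∞) :=
      (Nat.cast_le.mpr h).trans (hℓ ▸ le_self_add.trans hs)
    exact absurd (Nat.cast_le.mp this) (by omega)

/-- A module whose finitely generated submodules have bounded length is finitely generated. -/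
theorem finite_of_length_le (b : ℕ)
    (h : ∀ L : Submodule Γ M, L.FG → Module.length Γ L ≤ b) : Module.Finite Γ M := by
  have hlt : {m : ℕ | ∃ L : Submodule Γ M, L.FG ∧ Module.length Γ L = m}.Finite :=
    (Set.finite_Iic b).subset fun m ⟨L, hL, hm⟩ => by
      have := h L hL
      rw [hm] at this
      exact Nat.cast_le.mp this
  obtain ⟨m, ⟨L, hL, hm⟩, hmax⟩ := hlt.exists_maximal
    ⟨0, ⊥, Submodule.fg_bot, by simp⟩
  refine ⟨?_⟩
  suffices L = ⊤ from this ▸ hL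
  rw [eq_top_iff]
  intro x _
  by_contra hx
  have hfg : (L ⊔ Γ ∙ x).FG := hL.sup (Submodule.fg_span_singleton x)
  have hb := h _ hfg
  obtain ⟨m', hm'⟩ := ENat.ne_top_iff_exists.mp (ne_top_of_le_ne_top (ENat.natCast_ne_top b) hb)
  have hlt : L < L ⊔ Γ ∙ x := lt_of_le_of_ne le_sup_left fun he =>
    hx (he.symm ▸ (le_sup_right (a := L) (Submodule.mem_span_singleton_self x)))
  have hlen : Module.length Γ L < Module.length Γ (L ⊔ Γ ∙ x : Submodule Γ M) := by
    rw [Module.length_submodule, Module.length_submodule]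
    refine Order.height_strictMono hlt ?_
    rw [← Module.length_submodule, hm]
    exact ENat.natCast_lt_top m
  rw [hm, ← hm', Nat.cast_lt] at hlen
  exact absurd (hmax ⟨_, hfg, hm'.symm⟩ hlen.le) (by omega)

/-- An essential extension of a module of finite length is finitely generated if all of its
finitely generated submodules are cogenerated by `Γ`. -/
theorem finite_of_cogenerated_of_essential [IsArtinianRing Γ] [IsNoetherianRing Γ]
    {K : Submodule Γ M} (hK : IsEssential K) (hfg : K.FG)
    (h : ∀ L : Submodule Γ M, L.FG → Cogenerated Γ L) : Module.Finite Γ M := by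
  have := Module.Finite.iff_fg.mpr hfg
  obtain ⟨a, ha⟩ := ENat.ne_top_iff_exists.mp (Module.length_ne_top (R := Γ) (M := K))
  obtain ⟨c, hc⟩ := ENat.ne_top_iff_exists.mp (Module.length_ne_top (R := Γ) (M := Γ))
  refine finite_of_length_le (a * c) fun L hL => ?_
  have hKL : K ≤ K ⊔ L := le_sup_left
  obtain ⟨k, f, hf⟩ := h (K ⊔ L) (hfg.sup hL)
  let g : K →ₗ[Γ] (Fin k → Γ) := f ∘ₗ Submodule.inclusion hKL
  have hg : Function.Injective g := hf.comp (Submodule.inclusion_injective hKL)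
  -- At most `length K` coordinates are jointly injective on `K`, hence on its essential extension
  -- `K ⊔ L`. This bounds the length of `L` independently of `L` and `k`.
  obtain ⟨s, hs, hs0⟩ := exists_finset_card_le_inf_eq_bot
    (fun i => LinearMap.ker (LinearMap.proj i ∘ₗ g)) fun x hx => hg (by
      rw [map_zero]
      ext i
      exact hx i)
  let p : (K ⊔ L : Submodule Γ M) →ₗ[Γ] (s → Γ) := LinearMap.pi fun i => LinearMap.proj i.1 ∘ₗ f
  have hp : Function.Injective p := by
    rw [← LinearMap.ker_eq_bot]
    refine Submodule.map_injective_of_injective (K ⊔ L).subtype_injective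
      (Eq.trans (hK _ ?_) (Submodule.map_bot _).symm)
    rw [eq_bot_iff]
    rintro _ ⟨hxK, ⟨x, hx, rfl⟩⟩
    have hmem : (⟨x, hxK⟩ : K) ∈ s.inf fun i => LinearMap.ker (LinearMap.proj i ∘ₗ g) := by
      rw [Submodule.mem_finsetInf]
      intro i hi
      exact congrFun hx ⟨i, hi⟩
    rw [hs0, Submodule.mem_bot] at hmem
    simpa using congrArg Subtype.val hmem
  calc Module.length Γ L ≤ Module.length Γ (K ⊔ L : Submodule Γ M) :=
        Module.length_le_of_injective _ (Submodule.inclusion_injective le_sup_right)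
    _ ≤ Module.length Γ (s → Γ) := Module.length_le_of_injective p hp
    _ = s.card * Module.length Γ Γ := by simp
    _ ≤ Module.length Γ K * Module.length Γ Γ := by gcongr
    _ = (a * c : ℕ) := by rw [← ha, ← hc, Nat.cast_mul]

end Length
-- Existence of minimal injective coresolutions
section MinimalResolution

open Limits

variable {Γ : Type u} [Ring Γ]

/-- An injective hull of a module. -/
noncomputable def hull (M : ModuleCat.{u} Γ) : ModuleCat.{u} Γ :=
  (exists_injective_hull Γ M).choose

/-- The embedding of a module into its injective hull. -/
noncomputable def toHull (M : ModuleCat.{u} Γ) : M ⟶ hull M :=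
  ModuleCat.ofHom (exists_injective_hull Γ M).choose_spec.choose

theorem toHull_injective (M : ModuleCat.{u} Γ) : Function.Injective (toHull M).hom :=
  (exists_injective_hull Γ M).choose_spec.choose_spec.1

instance mono_toHull (M : ModuleCat.{u} Γ) : Mono (toHull M) :=
  (ModuleCat.mono_iff_injective _).mpr (toHull_injective M)

instance injective_hull (M : ModuleCat.{u} Γ) : Injective (hull M) :=
  have := (exists_injective_hull Γ M).choose_spec.choose_spec.2.1
  Module.injective_object_of_injective_module Γ (hull M) (inj := this)

theorem isEssential_range_toHull (M : ModuleCat.{u} Γ) :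
    IsEssential (LinearMap.range (toHull M).hom) :=
  (exists_injective_hull Γ M).choose_spec.choose_spec.2.2

/-- The iterated cosyzygies of a module, computed with injective hulls. -/
noncomputable def cosyzygy (M : ModuleCat.{u} Γ) : ℕ → ModuleCat.{u} Γ
  | 0 => M
  | i + 1 => cokernel (toHull (cosyzygy M i))

/-- The projection from an injective hull to the next cosyzygy. -/
noncomputable def toCosyzygy (M : ModuleCat.{u} Γ) (i : ℕ) :
    hull (cosyzygy M i) ⟶ cosyzygy M (i + 1) :=
  cokernel.π (toHull (cosyzygy M i))

theorem toCosyzygy_surjective (M : ModuleCat.{u} Γ) (i : ℕ) :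
    Function.Surjective (toCosyzygy M i).hom :=
  (ModuleCat.epi_iff_surjective _).mp (inferInstanceAs (Epi (cokernel.π _)))

theorem ker_toCosyzygy (M : ModuleCat.{u} Γ) (i : ℕ) :
    LinearMap.ker (toCosyzygy M i).hom = LinearMap.range (toHull (cosyzygy M i)).hom :=
  (ShortComplex.exact_cokernel (toHull (cosyzygy M i))).moduleCat_range_eq_ker.symm

/-- The differential of the minimal injective coresolution. -/
noncomputable def hullD (M : ModuleCat.{u} Γ) (i : ℕ) :
    hull (cosyzygy M i) ⟶ hull (cosyzygy M (i + 1)) :=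
  toCosyzygy M i ≫ toHull (cosyzygy M (i + 1))

theorem ker_hullD (M : ModuleCat.{u} Γ) (i : ℕ) :
    LinearMap.ker (hullD M i).hom = LinearMap.range (toHull (cosyzygy M i)).hom := by
  rw [hullD, ModuleCat.hom_comp, LinearMap.ker_comp,
    LinearMap.ker_eq_bot.mpr (toHull_injective _), ← ker_toCosyzygy]
  rfl

theorem range_hullD (M : ModuleCat.{u} Γ) (i : ℕ) :
    LinearMap.range (hullD M i).hom = LinearMap.range (toHull (cosyzygy M (i + 1))).hom := by
  rw [hullD, ModuleCat.hom_comp, LinearMap.range_comp,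
    LinearMap.range_eq_top.mpr (toCosyzygy_surjective M i), Submodule.map_top]

theorem toHull_comp_hullD (M : ModuleCat.{u} Γ) (i : ℕ) :
    toHull (cosyzygy M i) ≫ hullD M i = 0 := by
  ext x
  have : (toHull (cosyzygy M i)).hom x ∈ LinearMap.ker (hullD M i).hom :=
    ker_hullD M i ▸ ⟨x, rfl⟩
  exact this

theorem hullD_comp_hullD (M : ModuleCat.{u} Γ) (i : ℕ) : hullD M i ≫ hullD M (i + 1) = 0 := by
  ext x
  have : (hullD M i).hom x ∈ LinearMap.ker (hullD M (i + 1)).hom :=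
    ker_hullD M (i + 1) ▸ range_hullD M i ▸ ⟨x, rfl⟩
  exact this

theorem exact_toHull_hullD (M : ModuleCat.{u} Γ) (i : ℕ) :
    (ShortComplex.mk _ _ (toHull_comp_hullD M i)).Exact := by
  rw [ShortComplex.moduleCat_exact_iff_range_eq_ker]
  exact (ker_hullD M i).symm

/-- The minimal injective coresolution, as a complex. -/
noncomputable def hullComplex (M : ModuleCat.{u} Γ) : CochainComplex (ModuleCat.{u} Γ) ℕ :=
  CochainComplex.of (fun i => hull (cosyzygy M i)) (hullD M) (hullD_comp_hullD M)

theorem hullComplex_d (M : ModuleCat.{u} Γ) (i : ℕ) :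
    (hullComplex M).d i (i + 1) = hullD M i :=
  CochainComplex.of_d (fun i => hull (cosyzygy M i)) (hullD M) i

theorem hullComplex_exactAt_succ (M : ModuleCat.{u} Γ) (i : ℕ) :
    (hullComplex M).ExactAt (i + 1) := by
  rw [HomologicalComplex.exactAt_iff' _ i (i + 1) (i + 1 + 1) (by simp) (by simp)]
  rw [ShortComplex.moduleCat_exact_iff_range_eq_ker]
  change LinearMap.range ((hullComplex M).d i (i + 1)).hom =
    LinearMap.ker ((hullComplex M).d (i + 1) (i + 1 + 1)).hom
  rw [hullComplex_d, hullComplex_d]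
  exact (range_hullD M i).trans (ker_hullD M (i + 1)).symm

/-- A minimal injective coresolution. -/
noncomputable def minimalResolution (M : ModuleCat.{u} Γ) : InjectiveResolution M where
  cocomplex := hullComplex M
  injective i := injective_hull (cosyzygy M i)
  ι := (CochainComplex.fromSingle₀Equiv _ _).symm ⟨toHull M, by
    rw [hullComplex_d]; exact toHull_comp_hullD M 0⟩
  quasiIso := ⟨fun n => by
    cases n
    · rw [CochainComplex.quasiIsoAt₀_iff, ShortComplex.quasiIso_iff_of_zeros]
      · refine (ShortComplex.exact_and_mono_f_iff_of_iso ?_).2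
          ⟨exact_toHull_hullD M 0, mono_toHull M⟩
        exact ShortComplex.isoMk (Iso.refl _) (Iso.refl _) (Iso.refl _)
          (by simp; rfl) (
            (Category.id_comp (hullD M 0)).trans ((hullComplex_d M 0).symm.trans
              (Category.comp_id ((hullComplex M).d 0 1)).symm))
      all_goals rfl
    · rw [quasiIsoAt_iff_exactAt]
      · apply hullComplex_exactAt_succ
      · apply CochainComplex.exactAt_succ_single_obj⟩

theorem isMinimal_minimalResolution (M : ModuleCat.{u} Γ) : IsMinimal (minimalResolution M) := by
  intro i
  change IsEssential (LinearMap.ker ((hullComplex M).d i (i + 1)).hom)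
  rw [hullComplex_d]
  have := isEssential_range_toHull (cosyzygy M i)
  rw [← ker_hullD] at this
  exact this

end MinimalResolution

/-! ### Cocycles of an injective coresolution -/

section Resolution

variable {Γ : Type u} [Ring Γ] {M : ModuleCat.{u} Γ} (I : InjectiveResolution M)

/-- The coaugmentation of an injective coresolution. -/
noncomputable def coaugmentation : M →ₗ[Γ] I.cocomplex.X 0 :=
  ModuleCat.Hom.hom (show M ⟶ I.cocomplex.X 0 from I.ι.f 0)

theorem coaugmentation_injective : Function.Injective (coaugmentation I) :=
  (ModuleCat.mono_iff_injective (show M ⟶ I.cocomplex.X 0 from I.ι.f 0)).mp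
    (inferInstanceAs (Mono (I.ι.f 0)))

theorem range_coaugmentation :
    LinearMap.range (coaugmentation I) = LinearMap.ker (I.cocomplex.d 0 1).hom :=
  (ShortComplex.exact_of_f_is_kernel
    (ShortComplex.mk _ _ I.ι_f_zero_comp_complex_d) I.isLimitKernelFork).moduleCat_range_eq_ker

/-- The cocycles of an injective coresolution. -/
noncomputable abbrev cocycle (i : ℕ) : Submodule Γ (I.cocomplex.X i) :=
  LinearMap.ker (I.cocomplex.d i (i + 1)).hom

theorem range_d (i : ℕ) :
    LinearMap.range (I.cocomplex.d i (i + 1)).hom = cocycle I (i + 1) :=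
  (I.exact_succ i).moduleCat_range_eq_ker

/-- The differential as a map onto the next module of cocycles. -/
noncomputable def toCocycle (i : ℕ) : I.cocomplex.X i →ₗ[Γ] cocycle I (i + 1) :=
  (I.cocomplex.d i (i + 1)).hom.codRestrict _ fun x => range_d I i ▸ ⟨x, rfl⟩

theorem toCocycle_surjective (i : ℕ) : Function.Surjective (toCocycle I i) := by
  rintro ⟨x, hx⟩
  obtain ⟨y, rfl⟩ := (range_d I i).symm ▸ hx
  exact ⟨y, rfl⟩

theorem ker_toCocycle (i : ℕ) : LinearMap.ker (toCocycle I i) = cocycle I i :=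
  LinearMap.ker_codRestrict _ _ _

/-- The short complex of cocycles. -/
noncomputable abbrev cocycleComplex (i : ℕ) : ShortComplex (ModuleCat.{u} Γ) :=
  ModuleCat.shortComplexOfCompEqZero (cocycle I i).subtype (toCocycle I i) (by
    ext x
    have hx : (x : I.cocomplex.X i) ∈ LinearMap.ker (toCocycle I i) := by
      rw [ker_toCocycle]
      exact x.2
    exact Subtype.ext_iff.mp hx)

theorem shortExact_cocycleComplex (i : ℕ) : (cocycleComplex I i).ShortExact := by
  refine ModuleCat.shortComplex_shortExact _ ?_ (cocycle I i).subtype_injective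
    (toCocycle_surjective I i)
  rw [LinearMap.exact_iff]
  change LinearMap.ker (toCocycle I i) = LinearMap.range (cocycle I i).subtype
  rw [ker_toCocycle, Submodule.range_subtype]

/-- The base module is isomorphic to the zeroth module of cocycles. -/
noncomputable def equivCocycle : M ≃ₗ[Γ] cocycle I 0 :=
  (LinearEquiv.ofInjective _ (coaugmentation_injective I)).trans
    (LinearEquiv.ofEq _ _ (range_coaugmentation I))

end Resolution

/-! ### Vanishing of `Ext` by dimension shifting -/

section Ext

open Abelian

variable {Γ : Type u} [Ring Γ]

theorem ext_eq_zero_of_retract {S A B : ModuleCat.{u} Γ} (f : A ⟶ B) (g : B ⟶ A)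
    (h : f ≫ g = 𝟙 A) {j : ℕ} (hB : ∀ e : Ext S B j, e = 0) (e : Ext S A j) : e = 0 := by
  have := congrArg (fun t : Ext S B j => t.comp (Ext.mk₀ g) (add_zero j))
    (hB (e.comp (Ext.mk₀ f) (add_zero j)))
  simpa [h] using this

/-- The identity of `Γᵐ` is a sum of maps factoring through `Γ`. -/
theorem ext_pi_eq_zero {S : ModuleCat.{u} Γ} {j : ℕ}
    (h : ∀ e : Ext S (ModuleCat.of Γ Γ) j, e = 0) (m : ℕ)
    (e : Ext S (ModuleCat.of Γ (Fin m → Γ)) j) : e = 0 := by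
  let p (i : Fin m) : ModuleCat.of Γ (Fin m → Γ) ⟶ ModuleCat.of Γ Γ :=
    ModuleCat.ofHom (LinearMap.proj i)
  let q (i : Fin m) : ModuleCat.of Γ Γ ⟶ ModuleCat.of Γ (Fin m → Γ) :=
    ModuleCat.ofHom (LinearMap.single Γ (fun _ => Γ) i)
  have hsum : ∑ i, p i ≫ q i = 𝟙 _ := by
    refine ModuleCat.hom_ext (LinearMap.ext fun x => ?_)
    simp [p, q, ModuleCat.hom_sum, LinearMap.sum_apply, Finset.univ_sum_single]
  rw [← Ext.comp_mk₀_id e, ← hsum, Ext.mk₀_sum, Ext.comp_sum]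
  refine Finset.sum_eq_zero fun i _ => ?_
  rw [← Ext.mk₀_comp_mk₀, ← Ext.comp_assoc_of_third_deg_zero, h (e.comp _ _), Ext.zero_comp]

/-- Dimension shifting along an injective coresolution into whose first terms there are no nonzero
maps. -/
theorem ext_cocycle_eq_zero {M S : ModuleCat.{u} Γ} (I : InjectiveResolution M) (n : ℕ)
    (hS : ∀ i ≤ n, ∀ f : S →ₗ[Γ] I.cocomplex.X i, f = 0) :
    ∀ j i : ℕ, i + j ≤ n → ∀ e : Ext S (ModuleCat.of Γ (cocycle I i)) j, e = 0 := by
  intro j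
  induction j with
  | zero =>
    intro i hi e
    obtain ⟨f, rfl⟩ := (Ext.mk₀_bijective S (ModuleCat.of Γ (cocycle I i))).2 e
    have : f = 0 := by
      ext x
      exact LinearMap.congr_fun (hS i hi ((cocycle I i).subtype ∘ₗ f.hom)) x
    rw [this, Ext.mk₀_zero]
  | succ j ih =>
    intro i hi e
    have : Injective (cocycleComplex I i).X₂ := I.injective i
    -- The middle term is injective, so the class comes from degree `j` of the next cocycle module;
    -- `i + j` is preserved.
    obtain ⟨e', rfl⟩ := Ext.covariant_sequence_exact₁ S (shortExact_cocycleComplex I i) e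
      (Ext.eq_zero_of_injective _) rfl
    rw [ih (i + 1) (by omega) e', Ext.zero_comp]

theorem ext_eq_zero_of_injectiveResolution {M S : ModuleCat.{u} Γ} (I : InjectiveResolution M)
    (n : ℕ) (hS : ∀ i ≤ n, ∀ f : S →ₗ[Γ] I.cocomplex.X i, f = 0) (j : ℕ) (hj : j ≤ n)
    (e : Ext S M j) : e = 0 :=
  ext_eq_zero_of_retract (ModuleCat.ofHom (equivCocycle I).toLinearMap)
    (ModuleCat.ofHom (equivCocycle I).symm.toLinearMap) (by ext x; simp)
    (ext_cocycle_eq_zero I n hS j 0 (by omega)) e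

/-- A finitely generated module over a noetherian ring has a finite free cover with finitely
generated kernel. -/
theorem exists_free_cover [IsNoetherianRing Γ] (N : Type u) [AddCommGroup N] [Module Γ N]
    [Module.Finite Γ N] : ∃ (m : ℕ) (f : (Fin m → Γ) →ₗ[Γ] N), Function.Surjective f ∧
      Module.Finite Γ (LinearMap.ker f) := by
  obtain ⟨m, f, hf⟩ := Module.Finite.exists_fin' Γ N
  exact ⟨m, f, hf, inferInstance⟩

instance projective_of_pi (m : ℕ) : Projective (ModuleCat.of Γ (Fin m → Γ)) :=
  (IsProjective.iff_projective _).mp inferInstance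

/-- Dimension shifting along a free resolution. -/
theorem ext_eq_zero_of_hasProjectiveDimensionLT [IsNoetherianRing Γ] {S : ModuleCat.{u} Γ} (n : ℕ)
    (hS : ∀ j ≤ n, ∀ e : Ext S (ModuleCat.of Γ Γ) j, e = 0) :
    ∀ (k j : ℕ), k + j ≤ n → ∀ (N : Type u) [AddCommGroup N] [Module Γ N] [Module.Finite Γ N],
      HasProjectiveDimensionLT (ModuleCat.of Γ N) (k + 1) →
      ∀ e : Ext S (ModuleCat.of Γ N) j, e = 0 := by
  intro k
  induction k with
  | zero =>
    intro j hj N _ _ _ hN e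
    obtain ⟨m, f, hf, -⟩ := exists_free_cover (Γ := Γ) N
    have : Projective (ModuleCat.of Γ N) :=
      projective_iff_hasProjectiveDimensionLT_one.mpr hN
    have : Epi (ModuleCat.ofHom f) := (ModuleCat.epi_iff_surjective _).mpr hf
    exact ext_eq_zero_of_retract (Projective.factorThru (𝟙 _) (ModuleCat.ofHom f))
      (ModuleCat.ofHom f) (Projective.factorThru_comp _ _)
      (ext_pi_eq_zero (hS j (by omega)) m) e
  | succ k ih =>
    intro j hj N _ _ _ hN e
    obtain ⟨m, f, hf, hfin⟩ := exists_free_cover (Γ := Γ) N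
    have hse := LinearMap.shortExact_shortComplexKer hf
    have hK : HasProjectiveDimensionLT (ModuleCat.of Γ (LinearMap.ker f)) (k + 1) :=
      (hse.hasProjectiveDimensionLT_X₃_iff k (projective_of_pi m)).mp hN
    -- The obstruction to lifting `e` to the free cover lies in degree `j + 1` of the kernel, whose
    -- projective dimension is at most `k`.
    obtain ⟨e', rfl⟩ := Ext.covariant_sequence_exact₃ S hse e rfl (ih (j + 1) (by omega) _ hK _)
    rw [ext_pi_eq_zero (hS j (by omega)) m e', Ext.zero_comp]

end Ext

/-! ### Numerical forms of the dimension conditions -/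

section ProjectiveDimension

variable {Γ : Type u} [Ring Γ]

theorem pd_le_iff (N : Type u) [AddCommGroup N] [Module Γ N] (n : ℕ) :
    pd Γ N ≤ (n : WithBot ℕ∞) ↔ HasProjectiveDimensionLT (ModuleCat.of Γ N) (n + 1) :=
  projectiveDimension_le_iff _ _

theorem gldim_le_iff (n : ℕ) :
    gldim Γ ≤ (n : WithBot ℕ∞) ↔
      ∀ (N : Type u) [AddCommGroup N] [Module Γ N] [Module.Finite Γ N],
        HasProjectiveDimensionLT (ModuleCat.of Γ N) (n + 1) := by
  rw [gldim, iSup_le_iff]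
  exact ⟨fun h N _ _ _ => (pd_le_iff N n).mp (h (FGModuleCat.of Γ N)),
    fun h N => (pd_le_iff N n).mpr (h N)⟩

theorem le_domdim_iff (n : ℕ) :
    ((n + 1 : ℕ) : ℕ∞) ≤ domdim Γ ↔ ∃ I : InjectiveResolution (ModuleCat.of Γ Γ), IsMinimal I ∧
      ∀ j ≤ n, Module.Projective Γ (I.cocomplex.X j) := by
  constructor
  · intro h
    -- Strictness yields a member `d > n` of the set, so the supremum need not be attained.
    have hlt : (n : ℕ∞) < domdim Γ := lt_of_lt_of_le (by exact_mod_cast n.lt_succ_self) h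
    obtain ⟨d, ⟨I, hI, hd⟩, hnd⟩ := lt_sSup_iff.mp hlt
    exact ⟨I, hI, fun j hj => hd j (lt_of_le_of_lt (by exact_mod_cast hj) hnd)⟩
  · rintro ⟨I, hI, h⟩
    refine le_sSup ⟨I, hI, fun j hj => h j ?_⟩
    have : j < n + 1 := by exact_mod_cast hj
    omega

end ProjectiveDimension

/-! ### The two implications -/

section Main

variable {Γ : Type u} [Ring Γ]

theorem cogenerated_of_socle {M I : Type u} [AddCommGroup M] [Module Γ M] [IsArtinian Γ M]
    [AddCommGroup I] [Module Γ I] [Module.Injective Γ I] [Module.Projective Γ I]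
    (ι : Γ →ₗ[Γ] I) (hι : Function.Injective ι) (h : Cogenerated Γ (socle Γ M)) :
    Cogenerated Γ M := by
  refine cogenerated_of_simple ι hι fun S hS => ?_
  have := IsSimpleModule.nontrivial Γ S
  obtain ⟨x, hx⟩ := exists_ne (0 : S)
  have hx' : Submodule.inclusion (socle_ge hS) x ≠ 0 := fun h0 =>
    hx (Submodule.inclusion_injective (socle_ge hS) (h0.trans (map_zero _).symm))
  obtain ⟨f, hf⟩ := h.exists_apply_ne_zero hx'
  exact ⟨f ∘ₗ Submodule.inclusion (socle_ge hS), fun h0 => hf (LinearMap.congr_fun h0 x)⟩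

/-- `N` is a first syzygy of the finitely generated module `Γᵏ ⧸ N`. The index `n + 2` in `hgl`
encodes `pd ≤ n + 1`. -/
theorem Cogenerated.hasProjectiveDimensionLT [IsNoetherianRing Γ] {n : ℕ}
    (hgl : ∀ (N : Type u) [AddCommGroup N] [Module Γ N] [Module.Finite Γ N],
      HasProjectiveDimensionLT (ModuleCat.of Γ N) (n + 2))
    {N : Type u} [AddCommGroup N] [Module Γ N] (h : Cogenerated Γ N) :
    HasProjectiveDimensionLT (ModuleCat.of Γ N) (n + 1) := by
  obtain ⟨k, f, hf⟩ := h
  have hse : (ModuleCat.shortComplexOfCompEqZero f (LinearMap.range f).mkQ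
      (LinearMap.range_mkQ_comp f)).ShortExact :=
    ModuleCat.shortComplex_shortExact _ (LinearMap.exact_map_mkQ_range f) hf
      (Submodule.mkQ_surjective _)
  have : Projective (ModuleCat.of Γ (Fin k → Γ)) := projective_of_pi k
  exact hse.hasProjectiveDimensionLT_X₁ (n + 1)
    (hasProjectiveDimensionLT_of_ge (ModuleCat.of Γ (Fin k → Γ)) 1 (n + 1) (by omega)) (hgl _)

theorem cogenerated_of_hasProjectiveDimensionLT [IsArtinianRing Γ] [IsNoetherianRing Γ] {n : ℕ}
    (I : InjectiveResolution (ModuleCat.of Γ Γ))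
    (hI : ∀ j ≤ n, Module.Projective Γ (I.cocomplex.X j))
    (N : Type u) [AddCommGroup N] [Module Γ N] [Module.Finite Γ N]
    (hN : HasProjectiveDimensionLT (ModuleCat.of Γ N) (n + 1)) : Cogenerated Γ N := by
  have := hI 0 (Nat.zero_le n)
  have : Module.Injective Γ (I.cocomplex.X 0) :=
    Module.injective_module_of_injective_object Γ _ (inj := I.injective 0)
  refine cogenerated_of_simple (coaugmentation I) (coaugmentation_injective I) fun S hS => ?_
  by_contra! hzero
  -- Maps to `Γ` separate points of a projective module, so a nonzero map to `Iⁱ` would give one to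
  -- `Γ`.
  have hX : ∀ i ≤ n, ∀ f : ModuleCat.of Γ S →ₗ[Γ] I.cocomplex.X i, f = 0 := by
    intro i hi f
    have := hI i hi
    ext x
    by_contra hx
    obtain ⟨p, hp⟩ := exists_apply_ne_zero_of_projective (Γ := Γ) hx
    exact hp (LinearMap.congr_fun (hzero (p ∘ₗ f)) x)
  have h0 := ext_eq_zero_of_hasProjectiveDimensionLT n
    (ext_eq_zero_of_injectiveResolution I n hX) n 0 (by omega) N hN
    (Abelian.Ext.mk₀ (ModuleCat.ofHom S.subtype))
  rw [Abelian.Ext.mk₀_eq_zero_iff] at h0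
  have := IsSimpleModule.nontrivial Γ S
  obtain ⟨x, hx⟩ := exists_ne (0 : S)
  refine hx (Subtype.ext ?_)
  exact LinearMap.congr_fun (congrArg ModuleCat.Hom.hom h0) x

theorem IsEssential.simple_le {M : Type u} [AddCommGroup M] [Module Γ M] {K S : Submodule Γ M}
    (hK : IsEssential K) (hS : IsSimpleModule Γ S) : S ≤ K := by
  have hatom := isSimpleModule_iff_isAtom.mp hS
  rcases hatom.le_iff.mp (inf_le_right : K ⊓ S ≤ S) with h | h
  · exact absurd (hK S h) hatom.1
  · exact inf_eq_right.mp h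

/-- The socle of a submodule lies in every essential submodule. -/
theorem IsEssential.socle_le {M : Type u} [AddCommGroup M] [Module Γ M] {K : Submodule Γ M}
    (hK : IsEssential K) (L : Submodule Γ M) : (socle Γ L).map L.subtype ≤ K := by
  rw [Submodule.map_le_iff_le_comap]
  refine sSup_le fun S (hS : IsSimpleModule Γ S) => ?_
  rw [← Submodule.map_le_iff_le_comap]
  refine hK.simple_le ?_
  exact IsSimpleModule.congr (Submodule.equivMapOfInjective _ L.subtype_injective S).symm

theorem Cogenerated.projective {M : Type u} [AddCommGroup M] [Module Γ M] [Module.Injective Γ M]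
    (h : Cogenerated Γ M) : Module.Projective Γ M := by
  obtain ⟨k, f, hf⟩ := h
  obtain ⟨r, hr⟩ := Module.Injective.extension_property _ _ _ _ f hf LinearMap.id
  exact Module.Projective.of_split f r hr

theorem Cogenerated.finite [IsNoetherianRing Γ] {M : Type u} [AddCommGroup M] [Module Γ M]
    (h : Cogenerated Γ M) : Module.Finite Γ M := by
  obtain ⟨k, f, hf⟩ := h
  exact Module.Finite.of_injective f hf

theorem cogenerated_self : Cogenerated Γ Γ :=
  ⟨1, LinearMap.pi fun _ => LinearMap.id, fun _ _ h => congrFun h 0⟩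

/-- The injective hull of `Γ` is cogenerated by `Γ` if the modules cogenerated by `Γ` are
detected by their socles. -/
theorem cogenerated_of_essential [IsArtinianRing Γ] [IsNoetherianRing Γ]
    (hsoc : ∀ (N : Type u) [AddCommGroup N] [Module Γ N] [Module.Finite Γ N],
      Cogenerated Γ (socle Γ N) → Cogenerated Γ N)
    {E : Type u} [AddCommGroup E] [Module Γ E] {K : Submodule Γ E} (hK : IsEssential K)
    (hKΓ : Cogenerated Γ K) : Cogenerated Γ E := by
  have hfg : ∀ L : Submodule Γ E, L.FG → Cogenerated Γ L := by
    intro L hL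
    have := Module.Finite.iff_fg.mpr hL
    refine hsoc L (hKΓ.of_injective
      ((L.subtype ∘ₗ (socle Γ L).subtype).codRestrict K fun x =>
        hK.socle_le L ⟨x, x.2, rfl⟩) fun x y hxy => ?_)
    have hval : ((x : L) : E) = (y : L) := congrArg K.subtype hxy
    exact Subtype.ext (Subtype.ext hval)
  have := finite_of_cogenerated_of_essential hK (Module.Finite.iff_fg.mp hKΓ.finite) hfg
  exact (hfg ⊤ Module.Finite.fg_top).of_injective Submodule.topEquiv.symm.toLinearMap
    Submodule.topEquiv.symm.injective

/-- If `E` is injective, contains `Γ` and is cogenerated by `Γ`, then essential extensions of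
modules cogenerated by `Γ` are cogenerated by `Γ`. -/
theorem cogenerated_of_essential_of_injective [IsArtinianRing Γ] [IsNoetherianRing Γ]
    {E : Type u} [AddCommGroup E] [Module Γ E] [Module.Injective Γ E] (hE : Cogenerated Γ E)
    (ι : Γ →ₗ[Γ] E) (hι : Function.Injective ι)
    {X : Type u} [AddCommGroup X] [Module Γ X] {K : Submodule Γ X} (hK : IsEssential K)
    (hKΓ : Cogenerated Γ K) : Cogenerated Γ X := by
  obtain ⟨k, f, hf⟩ := hKΓ
  have := hE.finite
  have hJ : Cogenerated Γ (Fin k → E) := by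
    refine cogenerated_of_separating fun x hx => ?_
    obtain ⟨i, hi⟩ := Function.ne_iff.mp hx
    obtain ⟨p, hp⟩ := hE.exists_apply_ne_zero hi
    exact ⟨p ∘ₗ LinearMap.proj i, hp⟩
  -- Extend `K → Γᵏ → Eᵏ` to `X`; the extension is injective because it is so on the essential
  -- submodule `K`.
  obtain ⟨g, hg⟩ := Module.Injective.extension_property _ _ _ _ K.subtype K.subtype_injective
    (LinearMap.compLeft ι (Fin k) ∘ₗ f)
  refine hJ.of_injective g (hK.injective g fun x hx hgx => ?_)
  have h0 : LinearMap.compLeft ι (Fin k) (f ⟨x, hx⟩) = 0 :=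
    (LinearMap.congr_fun hg ⟨x, hx⟩).symm.trans hgx
  have h1 : f ⟨x, hx⟩ = 0 := by
    ext i
    exact hι ((congrFun h0 i).trans (map_zero ι).symm)
  exact congrArg Subtype.val (hf (h1.trans (map_zero f).symm))

/-- The invariant is that `Zʲ` is finitely generated with `pd ≤ j`. It puts `Zʲ` in `sub Γ`, which
makes `Iʲ` finitely generated projective, and the quotient `Zʲ⁺¹ = Iʲ / Zʲ` gains at most one in
projective dimension. -/
theorem projective_of_isMinimal [IsArtinianRing Γ] [IsNoetherianRing Γ] {n : ℕ}
    (hpd : ∀ (N : Type u) [AddCommGroup N] [Module Γ N] [Module.Finite Γ N],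
      HasProjectiveDimensionLT (ModuleCat.of Γ N) (n + 1) → Cogenerated Γ N)
    (hsoc : ∀ (N : Type u) [AddCommGroup N] [Module Γ N] [Module.Finite Γ N],
      Cogenerated Γ (socle Γ N) → Cogenerated Γ N)
    (I : InjectiveResolution (ModuleCat.of Γ Γ)) (hI : IsMinimal I) (j : ℕ) (hj : j ≤ n) :
    Module.Projective Γ (I.cocomplex.X j) := by
  have hinj : ∀ j, Module.Injective Γ (I.cocomplex.X j) := fun j =>
    Module.injective_module_of_injective_object Γ _ (inj := I.injective j)
  have h0 : Cogenerated Γ (I.cocomplex.X 0) :=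
    cogenerated_of_essential hsoc (hI 0) (cogenerated_self.of_injective
      (equivCocycle I).symm.toLinearMap (equivCocycle I).symm.injective)
  have hX : ∀ j ≤ n, Module.Finite Γ (cocycle I j) →
      HasProjectiveDimensionLT (ModuleCat.of Γ (cocycle I j)) (j + 1) →
      Cogenerated Γ (I.cocomplex.X j) := by
    intro j hj hfin hZ
    have := hinj 0
    exact cogenerated_of_essential_of_injective h0 (coaugmentation I) (coaugmentation_injective I)
      (hI j) (hpd _ (hasProjectiveDimensionLT_of_ge _ (j + 1) (n + 1) (by omega)))
  have key : ∀ j ≤ n, Module.Finite Γ (cocycle I j) ∧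
      HasProjectiveDimensionLT (ModuleCat.of Γ (cocycle I j)) (j + 1) := by
    intro j
    induction j with
    | zero =>
      intro _
      refine ⟨Module.Finite.equiv (equivCocycle I), ?_⟩
      have : Projective (ModuleCat.of Γ Γ) := (IsProjective.iff_projective _).mp inferInstance
      exact hasProjectiveDimensionLT_of_iso (equivCocycle I).toModuleIso 1
    | succ j ih =>
      intro hj
      obtain ⟨hfin, hZ⟩ := ih (by omega)
      have hc := hX j (by omega) hfin hZ
      have := hc.finite
      have := hinj j
      have hproj : Projective (ModuleCat.of Γ (I.cocomplex.X j)) :=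
        (IsProjective.iff_projective _).mp hc.projective
      exact ⟨Module.Finite.of_surjective _ (toCocycle_surjective I j),
        (shortExact_cocycleComplex I j).hasProjectiveDimensionLT_X₃ (j + 1) hZ
          (hasProjectiveDimensionLT_of_ge (ModuleCat.of Γ (I.cocomplex.X j)) 1 _ (by omega))⟩
  have := hinj j
  exact (hX j hj (key j hj).1 (key j hj).2).projective

theorem isAuslander_iff [IsArtinianRing Γ] [IsNoetherianRing Γ] (n : ℕ) :
    IsAuslander n Γ ↔ ∀ (N : Type u) [AddCommGroup N] [Module Γ N] [Module.Finite Γ N],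
      (pd Γ N ≤ (n : WithBot ℕ∞) ↔ pd Γ (socle Γ N) ≤ (n : WithBot ℕ∞)) ∧
        (pd Γ (socle Γ N) ≤ (n : WithBot ℕ∞) ↔ Cogenerated Γ N) := by
  rw [IsAuslander, gldim_le_iff, le_domdim_iff]
  constructor
  · rintro ⟨hgl, I, -, hproj⟩ N _ _ _
    have hiff : ∀ (N : Type u) [AddCommGroup N] [Module Γ N] [Module.Finite Γ N],
        pd Γ N ≤ (n : WithBot ℕ∞) ↔ Cogenerated Γ N := fun N _ _ _ =>
      (pd_le_iff N n).trans ⟨cogenerated_of_hasProjectiveDimensionLT I hproj N,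
        fun h => h.hasProjectiveDimensionLT hgl⟩
    have := hproj 0 (Nat.zero_le n)
    have : Module.Injective Γ (I.cocomplex.X 0) :=
      Module.injective_module_of_injective_object Γ _ (inj := I.injective 0)
    have hsoc : Cogenerated Γ (socle Γ N) ↔ Cogenerated Γ N :=
      ⟨cogenerated_of_socle (coaugmentation I) (coaugmentation_injective I),
        fun h => h.of_injective (socle Γ N).subtype (Submodule.subtype_injective _)⟩
    rw [hiff N, hiff (socle Γ N), hsoc]
    exact ⟨Iff.rfl, Iff.rfl⟩
  · intro h
    have hiff : ∀ (N : Type u) [AddCommGroup N] [Module Γ N] [Module.Finite Γ N],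
        pd Γ N ≤ (n : WithBot ℕ∞) ↔ Cogenerated Γ N := fun N _ _ _ => (h N).1.trans (h N).2
    refine ⟨fun N _ _ _ => ?_, minimalResolution _, isMinimal_minimalResolution _,
      projective_of_isMinimal (fun N _ _ _ hN => (hiff N).mp ((pd_le_iff N n).mpr hN))
        (fun N _ _ _ hN => (h N).2.mp ((hiff _).mpr hN)) _ (isMinimal_minimalResolution _)⟩
    -- The kernel of a free cover lies in `sub Γ`, so it has `pd ≤ n` and `N` has `pd ≤ n + 1`.
    obtain ⟨m, f, hf, hfin⟩ := exists_free_cover (Γ := Γ) N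
    refine ((LinearMap.shortExact_shortComplexKer hf).hasProjectiveDimensionLT_X₃_iff n
      (projective_of_pi m)).mpr ((pd_le_iff _ n).mp ((hiff _).mpr ?_))
    exact ⟨m, (LinearMap.ker f).subtype, Submodule.subtype_injective _⟩

end Main

end ArtinAlg

theorem corollary4p4 {R : Type*} {Γ : Type u} [CommRing R] [IsArtinianRing R] [Ring Γ]
    [Algebra R Γ] [Module.Finite R Γ] (n : ℕ) :
    ArtinAlg.IsAuslander n Γ ↔
      ArtinAlg.projDimLE n Γ = ArtinAlg.socleProjDimLE n Γ ∧
        ArtinAlg.socleProjDimLE n Γ = ArtinAlg.subReg Γ := by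
  -- The Artin algebra structure enters only through this; `Γ` is then also noetherian by
  -- Hopkins–Levitzki.
  have : IsArtinianRing Γ := isArtinian_of_tower R inferInstance
  rw [ArtinAlg.isAuslander_iff]
  constructor
  · intro h
    exact ⟨funext fun N => propext (h N).1, funext fun N => propext (h N).2⟩
  · rintro ⟨h₁, h₂⟩ N _ _ _
    exact ⟨iff_of_eq (congrFun h₁ (FGModuleCat.of Γ N)),
      iff_of_eq (congrFun h₂ (FGModuleCat.of Γ N))⟩
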